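/- **Setting.** Let $A,B\in\mathbb R^{n\times n}$ be symmetric, $[A,B]=AB-BA$, let $\|\cdot\|$ be the Euclidean norm and the induced operator norm, and let $\mathbb S^{n-1}$ be the unit sphere with geodesic distance $d(v,w)=\arccos\langle v,w\rangle$, tangent spaces $T_v\mathbb S^{n-1}=\{p:\langle p,v\rangle=0\}$ and retraction $R_v(p)=(v+p)/\|v+p\|$. Put $$\tilde{\mathcal L}(v)=\|Av-\langle v,Av\rangle v\|^2+\|Bv-\langle v,Bv\rangle v\|^2 ,$$ and let $\operatorname{grad}\tilde{\mathcal L}$ and $\operatorname{Hess}\tilde{\mathcal L}$ be its Riemannian gradient and Hessian on $\mathbb S^{n-1}$. Write $A=A_*+\Delta A$, $B=B_*+\Delta B$ with commuting symmetric $A_*,B_*$ such that $\|\Delta A\|+\|\Delta B\|\le C_0\|[A,B]\|^{1/2}$. **Algorithm.** For each $v\in\mathbb S^{n-1}$ let $H(v):T_v\mathbb S^{n-1}\to T_v\mathbb S^{n-1}$ be linear, symmetric and positive semidefinite. Let $\tau\in(0,1/2)$, $\beta\in(0,1)$ and $v_0\in\mathbb S^{n-1}$. The Riemannian quasi-Newton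 method (without stopping test) takes, for $k\ge 0$, a direction $s_k\in T_{v_k}\mathbb S^{n-1}$ with $-H(v_k)s_k=\operatorname{grad}\tilde{\mathcal L}(v_k)$, the step size $$\alpha_k=\max\{\beta^j:\ j\in\mathbb N_0,\ \tilde{\mathcal L}(R_{v_k}(\beta^js_k))\le\tilde{\mathcal L}(v_k)+\tau\beta^j\langle\operatorname{grad}\tilde{\mathcal L}(v_k),s_k\rangle\},$$ and sets $v_{k+1}=R_{v_k}(\alpha_ks_k)$. **Theorem 4.1.** Let $(v_k)$ be generated in this way and let $v_*$ be an accumulation point of $(v_k)$. Assume that $H(v_k)$, for all $k$, and $H(v_*)$ are nonsingular on the respective tangent spaces, and that $$\|\operatorname{Hess}\tilde{\mathcal L}(v)-H(v)\|\le c\,\|v-v_*\|+C_1(\|\Delta A\|+\|\Delta B\|)\qquad\text{for all } v\in\mathbb S^{n-1}\text{ near }v_*,$$ with the operator norm on $T_v\mathbb S^{n-1}$ and some constant $c$. 1. (Almost commuting case.) For all $C_0,C_1,\kappa>0$ there is a constant $C>0$, depending only on $C_0,C_1,\kappa$, and for every $\tau\in(0,1/2)$ there is a $\delta>0$, depending only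 on $C_0,C_1,\kappa,\tau$, such that if $0<\|[A,B]\|<\delta$ and $\|H(v_*)^{-1}\|\le\kappa$, then $v_k\to v_*$, $C\|[A,B]\|^{1/2}<1$, and $$d(v_{k+1},v_*)\le C\,\|[A,B]\|^{1/2}\,d(v_k,v_*)\qquad\text{for all sufficiently large }k.$$ 2. (Commuting case.) If $[A,B]=0$, then $v_k\to v_*$ quadratically: there is a constant $Q$ with $d(v_{k+1},v_*)\le Q\,d(v_k,v_*)^2$ for all sufficiently large $k$. -/

import Mathlib

open Filter Topology
open scoped Matrix.Norms.L2Operator InnerProductSpace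

noncomputable section

namespace SphereQN

/-- The Euclidean space `ℝⁿ`. -/
abbrev Vec (n : ℕ) : Type := EuclideanSpace ℝ (Fin n)

/-- The action of a real `n × n` matrix on `ℝⁿ`. -/
abbrev act {n : ℕ} (A : Matrix (Fin n) (Fin n) ℝ) : Vec n →L[ℝ] Vec n :=
  Matrix.toEuclideanCLM (n := Fin n) (𝕜 := ℝ) A

/-- The cost functional `𝓛(l, m, v) = ‖A v - l v‖² + ‖B v - m v‖²`. -/
def cost {n : ℕ} (A B : Matrix (Fin n) (Fin n) ℝ) (l m : ℝ) (v : Vec n) : ℝ :=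
  ‖act A v - l • v‖ ^ 2 + ‖act B v - m • v‖ ^ 2

/-- The reduced cost `v ↦ 𝓛(⟨v, A v⟩, ⟨v, B v⟩, v)`. It is a polynomial on all of `ℝⁿ`; the
problem is to minimize it on the unit sphere. -/
def redCost {n : ℕ} (A B : Matrix (Fin n) (Fin n) ℝ) (v : Vec n) : ℝ :=
  cost A B ⟪v, act A v⟫_ℝ ⟪v, act B v⟫_ℝ v

/-- The tangent space `{p | ⟨p, v⟩ = 0}` of the unit sphere at a unit vector `v`. -/
abbrev tangent {n : ℕ} (v : Vec n) : Submodule ℝ (Vec n) := (ℝ ∙ v)ᗮ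

/-- The Riemannian gradient at `v` of the restriction of `f` to the unit sphere,
`(I - v vᵀ) ∇f(v)`. -/
def riemGrad {n : ℕ} (f : Vec n → ℝ) (v : Vec n) : tangent v :=
  (tangent v).orthogonalProjectionOnto (gradient f v)

/-- The Riemannian Hessian at `v` of the restriction of `f` to the unit sphere,
`(I - v vᵀ) (∇²f(v) - ⟨∇f(v), v⟩ I)` as an operator on the tangent space. -/
def riemHess {n : ℕ} (f : Vec n → ℝ) (v : Vec n) : tangent v →L[ℝ] tangent v :=
  (tangent v).orthogonalProjectionOnto ∘L
    (fderiv ℝ (gradient f) v - ⟪gradient f v, v⟫_ℝ • ContinuousLinearMap.id ℝ (Vec n)) ∘L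
    (tangent v).subtypeL

/-- The retraction `R_v(p) = (v + p) / ‖v + p‖` on the unit sphere. -/
def retr {n : ℕ} (v p : Vec n) : Vec n := ‖v + p‖⁻¹ • (v + p)

/-- The geodesic distance `arccos ⟨v, w⟩` on the unit sphere. -/
def sphereDist {n : ℕ} (v w : Vec n) : ℝ := Real.arccos ⟪v, w⟫_ℝ

/-- One step `x ↦ y` of the Riemannian quasi-Newton method with approximate Hessian `H`:
the search direction `s`, tangent at `x`, solves `-H(x) s = grad`; the step size `α` is the
largest `β ^ j`, `j = 0, 1, 2, …`, which satisfies the sufficient decrease condition with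
parameter `τ`; and `y = R_x(α s)`. -/
def IsQuasiNewtonStep {n : ℕ} (A B : Matrix (Fin n) (Fin n) ℝ)
    (H : (v : Vec n) → (tangent v →L[ℝ] tangent v)) (τ β : ℝ) (x y : Vec n) : Prop :=
  ∃ (s : tangent x) (α : ℝ),
    -(H x s) = riemGrad (redCost A B) x ∧
    IsGreatest {t : ℝ | ∃ j : ℕ, t = β ^ j ∧
      redCost A B (retr x (β ^ j • (s : Vec n))) ≤
        redCost A B x + τ * β ^ j * ⟪riemGrad (redCost A B) x, s⟫_ℝ} α ∧
    y = retr x (α • (s : Vec n))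

/-- `v` is an infinite sequence of iterates of the Riemannian quasi-Newton method, started at
some point of the unit sphere and run without a stopping test. (A test `‖grad‖ ≤ ε` only
truncates the sequence. At a zero of the gradient with `H` nonsingular, the step is `0`.) -/
def IsQuasiNewtonRun {n : ℕ} (A B : Matrix (Fin n) (Fin n) ℝ)
    (H : (v : Vec n) → (tangent v →L[ℝ] tangent v)) (τ β : ℝ) (v : ℕ → Vec n) : Prop :=
  ‖v 0‖ = 1 ∧ ∀ k, IsQuasiNewtonStep A B H τ β (v k) (v (k + 1))

/-- `A = A_* + ΔA`, `B = B_* + ΔB` with commuting symmetric `A_*`, `B_*`, and with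
`‖ΔA‖ + ‖ΔB‖ ≤ C₀ ‖[A, B]‖^{1/2}` (operator norms). -/
structure IsAlmostCommutingDecomp {n : ℕ} (C₀ : ℝ)
    (A B As Bs ΔA ΔB : Matrix (Fin n) (Fin n) ℝ) : Prop where
  symm_left : As.IsSymm
  symm_right : Bs.IsSymm
  commute : As * Bs = Bs * As
  eq_left : A = As + ΔA
  eq_right : B = Bs + ΔB
  bound : ‖ΔA‖ + ‖ΔB‖ ≤ C₀ * √‖A * B - B * A‖

/-- The estimate `‖Hess(v) - H(v)‖ = O(‖v - v_*‖) + O(‖ΔA‖ + ‖ΔB‖)` for `v` on the unit sphere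
near `v_*`, in the operator norm on the tangent space at `v`. The second implied constant is
`C₁`. The first one, and the neighbourhood, may depend on everything. -/
def HessianEstimate {n : ℕ} (C₁ : ℝ) (A B ΔA ΔB : Matrix (Fin n) (Fin n) ℝ)
    (H : (v : Vec n) → (tangent v →L[ℝ] tangent v)) (vs : Vec n) : Prop :=
  ∃ c : ℝ, ∀ᶠ v in 𝓝[Metric.sphere (0 : Vec n) 1] vs,
    ‖riemHess (redCost A B) v - H v‖ ≤ c * ‖v - vs‖ + C₁ * (‖ΔA‖ + ‖ΔB‖)

end SphereQN

end

/-! A quasi-Newton step is a Newton step with a perturbed Hessian. Write E = C₁(‖ΔA‖ + ‖ΔB‖) and let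
r be the chordal distance from v to v_*. If v_* is stationary, the tangential part of v_* - v solves
the Newton equation at v up to O(r²) (`newton_residual_le`). Replacing the Hessian by H costs at
most (c r + E) r, and coercivity of H with constant h turns this into a direction error (E/h) r +
O(r²) (`norm_direction_sub_le`). The retraction adds O(r²), so the full step contracts with factor
E/h + O(r). With E of order ‖[A,B]‖^{1/2} this is the linear rate; with E = 0 it is quadratic
convergence.

Three facts make this applicable. H is uniformly coercive near v_* (`exists_localModel`). The point
v_* is stationary: backtracking decreases the cost by at least η‖grad‖² near v_*, impossible along
iterates accumulating at a nonstationary point (`gradient_eq`). The full step is accepted: the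
quadratic model predicts a decrease close to ⟨Hs,s⟩/2, while the test asks for τ⟨Hs,s⟩ with τ < 1/2
(`full_step_accepted`). Contraction then traps the sequence as soon as it enters a small ball.

The local analysis uses chords and a general smooth f; chord and arc agree up to the factor π/2. -/

namespace SphereQN

/-! ### Uniform Taylor estimates on the unit ball -/

section Taylor

variable {V : Type*} [NormedAddCommGroup V] [InnerProductSpace ℝ V] [FiniteDimensional ℝ V]

/-- Bounds on the gradient and the Hessian of `f` on the unit ball, with Taylor remainders. -/
structure TaylorBound (f : V → ℝ) (K : ℝ) : Prop where
  nonneg : 0 ≤ K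
  grad_le : ∀ x : V, ‖x‖ ≤ 1 → ‖gradient f x‖ ≤ K
  hess_le : ∀ x : V, ‖x‖ ≤ 1 → ‖fderiv ℝ (gradient f) x‖ ≤ K
  grad_lip : ∀ x y : V, ‖x‖ ≤ 1 → ‖y‖ ≤ 1 → ‖gradient f y - gradient f x‖ ≤ K * ‖y - x‖
  hess_lip : ∀ x y : V, ‖x‖ ≤ 1 → ‖y‖ ≤ 1 →
    ‖fderiv ℝ (gradient f) y - fderiv ℝ (gradient f) x‖ ≤ K * ‖y - x‖
  grad_taylor : ∀ x y : V, ‖x‖ ≤ 1 → ‖y‖ ≤ 1 →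
    ‖gradient f y - gradient f x - fderiv ℝ (gradient f) x (y - x)‖ ≤ K * ‖y - x‖ ^ 2
  taylor : ∀ x y : V, ‖x‖ ≤ 1 → ‖y‖ ≤ 1 →
    |f y - f x - ⟪gradient f x, y - x⟫_ℝ
      - ⟪fderiv ℝ (gradient f) x (y - x), y - x⟫_ℝ / 2| ≤ K * ‖y - x‖ ^ 3

theorem contDiff_gradient {f : V → ℝ} {m k : WithTop ℕ∞} (hf : ContDiff ℝ k f) (h : m + 1 ≤ k) :
    ContDiff ℝ m (gradient f) :=
  (InnerProductSpace.toDual ℝ V).symm.toContinuousLinearEquiv.contDiff.comp (hf.fderiv_right h)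

theorem exists_norm_le_on_ball {W : Type*} [NormedAddCommGroup W] {g : V → W}
    (hg : Continuous g) : ∃ K : ℝ, ∀ x : V, ‖x‖ ≤ 1 → ‖g x‖ ≤ K := by
  obtain ⟨K, hK⟩ := (isCompact_closedBall (0 : V) 1).exists_bound_of_continuousOn hg.continuousOn
  exact ⟨K, fun x hx => hK x (by simpa using hx)⟩

/-- The gradient and its first two derivatives are continuous, hence bounded on the compact ball;
convexity of the ball and the mean value inequality give the rest. -/
theorem exists_taylorBound {f : V → ℝ} (hf : ContDiff ℝ 3 f) : ∃ K, TaylorBound f K := by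
  have hg : ContDiff ℝ 2 (gradient f) := contDiff_gradient hf (by norm_num)
  have hD : ContDiff ℝ 1 (fderiv ℝ (gradient f)) := hg.fderiv_right (by norm_num)
  have hDD : ContDiff ℝ 0 (fderiv ℝ (fderiv ℝ (gradient f))) := hD.fderiv_right (by norm_num)
  obtain ⟨K₁, h₁⟩ := exists_norm_le_on_ball hg.continuous
  obtain ⟨K₂, h₂⟩ := exists_norm_le_on_ball hD.continuous
  obtain ⟨K₃, h₃⟩ := exists_norm_le_on_ball hDD.continuous
  obtain ⟨K, hK₁, hK₂, hK₃⟩ : ∃ K, K₁ ≤ K ∧ K₂ ≤ K ∧ K₃ ≤ K :=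
    ⟨max K₁ (max K₂ K₃), le_max_left _ _, (le_max_left _ _).trans (le_max_right _ _),
      (le_max_right _ _).trans (le_max_right _ _)⟩
  have hK0 : 0 ≤ K := (norm_nonneg _).trans ((h₁ 0 (by simp)).trans hK₁)
  have hconv : Convex ℝ (Metric.closedBall (0 : V) 1) := convex_closedBall 0 1
  have mem : ∀ {x : V}, ‖x‖ ≤ 1 → x ∈ Metric.closedBall (0 : V) 1 := fun hx => by simpa using hx
  have mem' : ∀ {x : V}, x ∈ Metric.closedBall (0 : V) 1 → ‖x‖ ≤ 1 := fun hx => by simpa using hx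
  have hlipD : ∀ x y : V, ‖x‖ ≤ 1 → ‖y‖ ≤ 1 →
      ‖fderiv ℝ (gradient f) y - fderiv ℝ (gradient f) x‖ ≤ K * ‖y - x‖ := fun x y hx hy =>
    hconv.norm_image_sub_le_of_norm_fderiv_le
      (fun z _ => (hD.differentiable (by norm_num)).differentiableAt)
      (fun z hz => (h₃ z (mem' hz)).trans hK₃) (mem hx) (mem hy)
  have hseg : ∀ x y : V, ‖x‖ ≤ 1 → ‖y‖ ≤ 1 → ∀ t ∈ Set.Icc (0 : ℝ) 1, ‖x + t • (y - x)‖ ≤ 1 :=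
    fun x y hx hy t ht => mem' (hconv.add_smul_sub_mem (mem hx) (mem hy) ht)
  have htay : ∀ x y : V, ‖x‖ ≤ 1 → ‖y‖ ≤ 1 →
      ‖gradient f y - gradient f x - fderiv ℝ (gradient f) x (y - x)‖ ≤ K * ‖y - x‖ ^ 2 := by
    intro x y hx hy
    -- The mean value inequality on the segment alone: there the derivative differs from its value
    -- at x by at most K‖y - x‖.
    have h := (convex_segment (𝕜 := ℝ) x y).norm_image_sub_le_of_norm_fderiv_le' (f := gradient f)
      (φ := fderiv ℝ (gradient f) x) (C := K * ‖y - x‖)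
      (fun z _ => (hg.differentiable (by norm_num)).differentiableAt) (fun z hz => ?_)
      (left_mem_segment ℝ x y) (right_mem_segment ℝ x y)
    · calc _ ≤ _ := h
        _ = _ := by ring
    · rw [segment_eq_image'] at hz
      obtain ⟨t, ht, rfl⟩ := hz
      refine (hlipD x _ hx (hseg x y hx hy t ht)).trans ?_
      gcongr
      rw [add_sub_cancel_left, norm_smul, Real.norm_of_nonneg ht.1]
      exact mul_le_of_le_one_left (norm_nonneg _) ht.2
  refine ⟨K, hK0, fun x hx => (h₁ x hx).trans hK₁, fun x hx => (h₂ x hx).trans hK₂,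
    fun x y hx hy => ?_, hlipD, htay, fun x y hx hy => ?_⟩
  · exact hconv.norm_image_sub_le_of_norm_fderiv_le
      (fun z _ => (hg.differentiable (by norm_num)).differentiableAt)
      (fun z hz => (h₂ z (mem' hz)).trans hK₂) (mem hx) (mem hy)
  · set u := y - x with hu
    set a := ⟪gradient f x, u⟫_ℝ
    set b := ⟪fderiv ℝ (gradient f) x u, u⟫_ℝ
    -- Subtract from f along the segment its quadratic Taylor polynomial; the derivative of the
    -- difference is controlled by the first-order remainder of the gradient.
    have hder : ∀ t : ℝ, HasDerivAt (fun t : ℝ => f (x + t • u) - t * a - t ^ 2 * (b / 2))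
        (⟪gradient f (x + t • u), u⟫_ℝ - a - t * b) t := by
      intro t
      have hγ : HasDerivAt (fun t : ℝ => x + t • u) u t := by
        simpa using ((hasDerivAt_id t).smul_const u).const_add x
      have hfd : HasFDerivAt f (fderiv ℝ f (x + t • u)) (x + t • u) :=
        ((hf.differentiable (by norm_num)).differentiableAt).hasFDerivAt
      have h1 := hfd.comp_hasDerivAt t hγ
      have h2 : fderiv ℝ f (x + t • u) u = ⟪gradient f (x + t • u), u⟫_ℝ := by
        simp [gradient]
      rw [h2] at h1
      have h3 := (h1.sub ((hasDerivAt_id t).mul_const a)).sub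
        (((hasDerivAt_id t).pow 2).mul_const (b / 2))
      refine h3.congr_deriv ?_
      simp
      ring
    have hb : ∀ t ∈ Set.Icc (0 : ℝ) 1,
        ‖⟪gradient f (x + t • u), u⟫_ℝ - a - t * b‖ ≤ K * ‖u‖ ^ 3 := by
      intro t ht
      have h1 := htay x _ hx (hseg x y hx hy t ht)
      have h2 : ⟪gradient f (x + t • u), u⟫_ℝ - a - t * b =
          ⟪gradient f (x + t • u) - gradient f x
            - fderiv ℝ (gradient f) x (x + t • u - x), u⟫_ℝ := by
        rw [add_sub_cancel_left, map_smul, inner_sub_left, inner_sub_left, real_inner_smul_left]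
      rw [h2]
      refine (norm_inner_le_norm _ _).trans ?_
      have h3 : ‖x + t • u - x‖ ≤ ‖u‖ := by
        rw [add_sub_cancel_left, norm_smul, Real.norm_of_nonneg ht.1]
        exact mul_le_of_le_one_left (norm_nonneg _) ht.2
      calc _ ≤ K * ‖x + t • u - x‖ ^ 2 * ‖u‖ := by gcongr
        _ ≤ K * ‖u‖ ^ 2 * ‖u‖ := by gcongr
        _ = _ := by ring
    have h := (convex_Icc (0 : ℝ) 1).norm_image_sub_le_of_norm_hasDerivWithin_le
      (fun t _ => (hder t).hasDerivWithinAt) hb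
      (Set.left_mem_Icc.2 zero_le_one) (Set.right_mem_Icc.2 zero_le_one)
    rw [← Real.norm_eq_abs]
    have e1 : x + (1 : ℝ) • u = y := by simp [hu]
    simp only [e1, zero_smul, add_zero, sub_zero, norm_one, mul_one, one_mul, zero_mul] at h
    refine le_of_eq_of_le (congrArg _ ?_) h
    ring

end Taylor

/-! ### Expansion of the retraction, chords and tangential projections -/

variable {n : ℕ}

theorem norm_add_sq_of_orthogonal {v s : Vec n} (hv : ‖v‖ = 1) (hs : ⟪v, s⟫_ℝ = 0) :
    ‖v + s‖ ^ 2 = 1 + ‖s‖ ^ 2 := by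
  rw [norm_add_sq_real, hv, hs]; ring

theorem one_le_norm_add {v s : Vec n} (hv : ‖v‖ = 1) (hs : ⟪v, s⟫_ℝ = 0) : 1 ≤ ‖v + s‖ := by
  have := norm_add_sq_of_orthogonal hv hs
  nlinarith [norm_nonneg (v + s), sq_nonneg ‖s‖]

theorem norm_retr {v s : Vec n} (hv : ‖v‖ = 1) (hs : ⟪v, s⟫_ℝ = 0) : ‖retr v s‖ = 1 := by
  have := one_le_norm_add hv hs
  rw [retr, norm_smul, norm_inv, norm_norm, inv_mul_cancel₀ (by linarith)]

theorem norm_retr_sub_sub_le {v s : Vec n} (hv : ‖v‖ = 1) (hs : ⟪v, s⟫_ℝ = 0) :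
    ‖retr v s - v - s‖ ≤ ‖s‖ ^ 2 / 2 := by
  have h1 := one_le_norm_add hv hs
  have h2 := norm_add_sq_of_orthogonal hv hs
  have h3 : retr v s - v - s = (‖v + s‖⁻¹ - 1) • (v + s) := by
    rw [retr, sub_smul, one_smul]; abel
  have h4 : ‖v + s‖⁻¹ ≤ 1 := inv_le_one_of_one_le₀ h1
  rw [h3, norm_smul, Real.norm_of_nonpos (by linarith), neg_sub, sub_mul,
    inv_mul_cancel₀ (by linarith)]
  nlinarith [sq_nonneg (‖v + s‖ - 1)]

theorem norm_retr_sub_le {v s : Vec n} (hv : ‖v‖ = 1) (hs : ⟪v, s⟫_ℝ = 0) :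
    ‖retr v s - v‖ ≤ ‖s‖ := by
  have h1 := one_le_norm_add hv hs
  have h2 := norm_add_sq_of_orthogonal hv hs
  have h3 : ⟪retr v s, v⟫_ℝ = ‖v + s‖⁻¹ := by
    rw [retr, real_inner_smul_left, inner_add_left, real_inner_self_eq_norm_sq, hv,
      real_inner_comm, hs]; simp
  have h4 : ‖retr v s - v‖ ^ 2 = 2 - 2 * ‖v + s‖⁻¹ := by
    rw [norm_sub_sq_real, norm_retr hv hs, hv, h3]; ring
  refine (sq_le_sq₀ (norm_nonneg _) (norm_nonneg _)).1 ?_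
  rw [h4]
  have h5 : ‖v + s‖⁻¹ * ‖v + s‖ = 1 := inv_mul_cancel₀ (by linarith)
  have h6 : 0 < ‖v + s‖⁻¹ := by positivity
  nlinarith [mul_nonneg h6.le (sq_nonneg (‖v + s‖ - 1)), sq_nonneg (‖v + s‖ - 1),
    mul_nonneg (mul_nonneg h6.le (sq_nonneg (‖v + s‖ - 1))) (by linarith : 0 ≤ ‖v + s‖)]

/-- The second-order motion of the retraction is radial. This is the source of the multiplier term
-⟨∇f(v), v⟩ I in the Riemannian Hessian. -/
theorem norm_retr_sub_expansion_le {v s : Vec n} (hv : ‖v‖ = 1) (hs : ⟪v, s⟫_ℝ = 0) :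
    ‖retr v s - v - s + (‖s‖ ^ 2 / 2) • v‖ ≤ 2 * ‖s‖ ^ 3 := by
  have h1 := one_le_norm_add hv hs
  have h2 := norm_add_sq_of_orthogonal hv hs
  set b := ‖v + s‖ with hb
  set σ := ‖s‖ with hσ
  have hσ0 : 0 ≤ σ := norm_nonneg _
  have h3 : retr v s - v - s + (σ ^ 2 / 2) • v = (b⁻¹ - 1 + σ ^ 2 / 2) • v + (b⁻¹ - 1) • s := by
    rw [retr, ← hb]; module
  have h5 : b⁻¹ * b = 1 := inv_mul_cancel₀ (by linarith)
  have h4 : b⁻¹ ≤ 1 := inv_le_one_of_one_le₀ h1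
  have h6 : 0 < b⁻¹ := by positivity
  have e1 : b⁻¹ - 1 + σ ^ 2 / 2 = (b - 1) ^ 2 * (1 + 2 * b⁻¹) / 2 := by
    have : σ ^ 2 = b ^ 2 - 1 := by linarith
    rw [this]; linear_combination (-(b - 2)) * h5
  have hbσ : b - 1 ≤ σ := by
    have : b ≤ ‖v‖ + ‖s‖ := norm_add_le _ _
    linarith
  have hbσ2 : b - 1 ≤ σ ^ 2 / 2 := by nlinarith [sq_nonneg (b - 1)]
  -- One factor is bounded linearly and the other quadratically in σ, so the cubic bound needs no
  -- smallness of σ.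
  have e2 : (b - 1) ^ 2 ≤ σ ^ 3 / 2 := by
    calc (b - 1) ^ 2 = (b - 1) * (b - 1) := by ring
      _ ≤ σ * (σ ^ 2 / 2) := by gcongr
      _ = _ := by ring
  have e3 : 1 - b⁻¹ ≤ σ ^ 2 / 2 := by nlinarith [sq_nonneg (b - 1)]
  rw [h3]
  refine (norm_add_le _ _).trans ?_
  rw [norm_smul, norm_smul, hv, e1, Real.norm_of_nonneg (by positivity),
    Real.norm_of_nonpos (by linarith)]
  have e4 : (b - 1) ^ 2 * (1 + 2 * b⁻¹) ≤ σ ^ 3 / 2 * 3 := by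
    gcongr; linarith
  have e5 : -(b⁻¹ - 1) * σ ≤ σ ^ 2 / 2 * σ := by
    gcongr; linarith
  have : 0 ≤ σ ^ 3 := by positivity
  nlinarith

/-- The orthogonal projection of `w` to the tangent space at `v` is within `‖v - w‖` of zero. -/
theorem norm_sub_inner_smul_le {v w : Vec n} (hv : ‖v‖ = 1) (hw : ‖w‖ = 1) :
    ‖w - ⟪v, w⟫_ℝ • v‖ ≤ ‖v - w‖ := by
  have hr2 : ‖v - w‖ ^ 2 = 2 - 2 * ⟪v, w⟫_ℝ := by
    rw [norm_sub_sq_real, hv, hw]; ring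
  refine (sq_le_sq₀ (norm_nonneg _) (norm_nonneg _)).1 ?_
  rw [hr2, norm_sub_sq_real, real_inner_smul_right, real_inner_comm w v, norm_smul, hv, hw,
    Real.norm_eq_abs, mul_one, sq_abs]
  nlinarith [sq_nonneg (⟪w, v⟫_ℝ - 1)]

theorem norm_sub_sub_sub_inner_smul {v w : Vec n} (hv : ‖v‖ = 1) (hw : ‖w‖ = 1) :
    ‖w - v - (w - ⟪v, w⟫_ℝ • v)‖ = ‖v - w‖ ^ 2 / 2 := by
  have hr2 : ‖v - w‖ ^ 2 = 2 - 2 * ⟪v, w⟫_ℝ := by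
    rw [norm_sub_sq_real, hv, hw]; ring
  have hep : w - v - (w - ⟪v, w⟫_ℝ • v) = (-(‖v - w‖ ^ 2 / 2)) • v := by
    rw [hr2]; module
  rw [hep, norm_smul, hv, mul_one, norm_neg, Real.norm_of_nonneg (by positivity)]

/-! ### Riemannian gradient and Hessian in ambient coordinates -/

theorem inner_of_tangent {v : Vec n} (s : tangent v) : ⟪v, (s : Vec n)⟫_ℝ = 0 :=
  Submodule.mem_orthogonal_singleton_iff_inner_right.1 s.2

/-- The operator `∇²f(v) - ⟨∇f(v), v⟩ I`, whose compression to the tangent space is the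
Riemannian Hessian. -/
noncomputable def ambientHess (f : Vec n → ℝ) (v : Vec n) : Vec n →L[ℝ] Vec n :=
  fderiv ℝ (gradient f) v - ⟪gradient f v, v⟫_ℝ • ContinuousLinearMap.id ℝ (Vec n)

theorem ambientHess_apply (f : Vec n → ℝ) (v p : Vec n) :
    ambientHess f v p = fderiv ℝ (gradient f) v p - ⟪gradient f v, v⟫_ℝ • p := rfl

theorem inner_riemGrad (f : Vec n → ℝ) {v : Vec n} (s : tangent v) :
    ⟪riemGrad f v, s⟫_ℝ = ⟪gradient f v, (s : Vec n)⟫_ℝ := by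
  rw [riemGrad, Submodule.inner_orthogonalProjectionOnto_eq_of_mem_right]

theorem inner_riemHess (f : Vec n → ℝ) {v : Vec n} (s t : tangent v) :
    ⟪riemHess f v s, t⟫_ℝ = ⟪ambientHess f v (s : Vec n), (t : Vec n)⟫_ℝ := by
  change ⟪(tangent v).orthogonalProjectionOnto (ambientHess f v (s : Vec n)), t⟫_ℝ = _
  rw [Submodule.inner_orthogonalProjectionOnto_eq_of_mem_right]

namespace TaylorBound

variable {f : Vec n → ℝ} {K : ℝ}

theorem norm_ambientHess_le (hK : TaylorBound f K) {v : Vec n} (hv : ‖v‖ = 1) :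
    ‖ambientHess f v‖ ≤ 2 * K := by
  have h1 := hK.hess_le v hv.le
  have h2 := hK.grad_le v hv.le
  have h3 : |⟪gradient f v, v⟫_ℝ| ≤ K := by
    refine (abs_real_inner_le_norm _ _).trans ?_
    rw [hv, mul_one]; exact h2
  have h4 : ‖⟪gradient f v, v⟫_ℝ • ContinuousLinearMap.id ℝ (Vec n)‖ ≤ K * 1 := by
    rw [norm_smul]
    exact mul_le_mul h3 ContinuousLinearMap.norm_id_le (norm_nonneg _) hK.nonneg
  refine (norm_sub_le _ _).trans ?_
  linarith

theorem abs_inner_gradient_self_sub_le (hK : TaylorBound f K) {v w : Vec n} (hv : ‖v‖ = 1)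
    (hw : ‖w‖ = 1) :
    |⟪gradient f v, v⟫_ℝ - ⟪gradient f w, w⟫_ℝ| ≤ 2 * K * ‖v - w‖ := by
  have e : ⟪gradient f v, v⟫_ℝ - ⟪gradient f w, w⟫_ℝ =
      ⟪gradient f v - gradient f w, v⟫_ℝ + ⟪gradient f w, v - w⟫_ℝ := by
    rw [inner_sub_left, inner_sub_right]; ring
  have h1 := abs_real_inner_le_norm (gradient f v - gradient f w) v
  have h2 := abs_real_inner_le_norm (gradient f w) (v - w)
  have h3 := hK.grad_lip w v hw.le hv.le
  have h4 := mul_le_mul_of_nonneg_right (hK.grad_le w hw.le) (norm_nonneg (v - w))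
  rw [hv] at h1
  rw [e]
  refine (abs_add_le _ _).trans ?_
  linarith

theorem norm_ambientHess_sub_le (hK : TaylorBound f K) {v w : Vec n} (hv : ‖v‖ = 1)
    (hw : ‖w‖ = 1) : ‖ambientHess f v - ambientHess f w‖ ≤ 3 * K * ‖v - w‖ := by
  have e : ambientHess f v - ambientHess f w =
      (fderiv ℝ (gradient f) v - fderiv ℝ (gradient f) w) -
      (⟪gradient f v, v⟫_ℝ - ⟪gradient f w, w⟫_ℝ) • ContinuousLinearMap.id ℝ (Vec n) := by
    rw [ambientHess, ambientHess]; module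
  have h1 := hK.hess_lip w v hw.le hv.le
  have h2 := hK.abs_inner_gradient_self_sub_le hv hw
  have h4 : ‖(⟪gradient f v, v⟫_ℝ - ⟪gradient f w, w⟫_ℝ) • ContinuousLinearMap.id ℝ (Vec n)‖
      ≤ 2 * K * ‖v - w‖ * 1 := by
    rw [norm_smul]
    exact mul_le_mul h2 ContinuousLinearMap.norm_id_le (norm_nonneg _) ((abs_nonneg _).trans h2)
  rw [e]
  refine (norm_sub_le _ _).trans ?_
  linarith

/-- Second order expansion of `f` along the retraction. -/
theorem retr_expansion (hK : TaylorBound f K) {v s : Vec n} (hv : ‖v‖ = 1)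
    (hs : ⟪v, s⟫_ℝ = 0) :
    |f (retr v s) - f v - ⟪gradient f v, s⟫_ℝ - ⟪ambientHess f v s, s⟫_ℝ / 2|
      ≤ 4 * K * ‖s‖ ^ 3 := by
  have hK0 := hK.nonneg
  have h1 := hK.taylor v (retr v s) hv.le (norm_retr hv hs).le
  have h2 := norm_retr_sub_le hv hs
  have h3 := norm_retr_sub_sub_le hv hs
  have h4 := norm_retr_sub_expansion_le hv hs
  set u := retr v s - v with hu
  set D := fderiv ℝ (gradient f) v
  set g := gradient f v
  have hD : ‖D‖ ≤ K := hK.hess_le v hv.le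
  have hg : ‖g‖ ≤ K := hK.grad_le v hv.le
  have a1 : |⟪g, u - s + (‖s‖ ^ 2 / 2) • v⟫_ℝ| ≤ K * (2 * ‖s‖ ^ 3) :=
    (abs_real_inner_le_norm _ _).trans (mul_le_mul hg h4 (norm_nonneg _) hK0)
  have a2 : |⟪D (u - s), u⟫_ℝ| ≤ K * (‖s‖ ^ 2 / 2) * ‖s‖ :=
    (abs_real_inner_le_norm _ _).trans (mul_le_mul
      ((D.le_opNorm _).trans (mul_le_mul hD h3 (norm_nonneg _) hK0)) h2 (norm_nonneg _)
      (by positivity))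
  have a3 : |⟪D s, u - s⟫_ℝ| ≤ K * ‖s‖ * (‖s‖ ^ 2 / 2) :=
    (abs_real_inner_le_norm _ _).trans (mul_le_mul
      ((D.le_opNorm _).trans (mul_le_mul_of_nonneg_right hD (norm_nonneg _))) h3 (norm_nonneg _)
      (by positivity))
  have a4 : K * ‖u‖ ^ 3 ≤ K * ‖s‖ ^ 3 := by gcongr
  -- The radial shift -(‖s‖²/2) v, paired with the gradient, is exactly the multiplier term of
  -- `ambientHess`; every other summand is cubic in ‖s‖.
  have e : f (retr v s) - f v - ⟪g, s⟫_ℝ - ⟪ambientHess f v s, s⟫_ℝ / 2 =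
      (f (retr v s) - f v - ⟪g, u⟫_ℝ - ⟪D u, u⟫_ℝ / 2) + ⟪g, u - s + (‖s‖ ^ 2 / 2) • v⟫_ℝ
      + ⟪D (u - s), u⟫_ℝ / 2 + ⟪D s, u - s⟫_ℝ / 2 := by
    rw [ambientHess_apply]
    simp only [map_sub, inner_sub_left, inner_sub_right, inner_add_right, real_inner_smul_right,
      real_inner_smul_left, real_inner_self_eq_norm_sq]
    ring
  rw [e]
  rw [abs_le] at *
  constructor <;> nlinarith

/-- First order upper bound for `f` along the retraction. -/
theorem retr_le (hK : TaylorBound f K) {v s : Vec n} (hv : ‖v‖ = 1) (hs : ⟪v, s⟫_ℝ = 0) :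
    f (retr v s) ≤ f v + ⟪gradient f v, s⟫_ℝ + 4 * K * ‖s‖ ^ 2 := by
  have hK0 := hK.nonneg
  have h1 := (abs_le.1 (hK.taylor v (retr v s) hv.le (norm_retr hv hs).le)).2
  have h2 := norm_retr_sub_le hv hs
  have h3 := norm_retr_sub_sub_le hv hs
  -- Bounded chords let the cubic Taylor remainder be absorbed into the quadratic term, so steps of
  -- any length are covered.
  have h5 : ‖retr v s - v‖ ≤ 2 := by
    refine (norm_sub_le _ _).trans ?_
    rw [norm_retr hv hs, hv]; norm_num
  set u := retr v s - v with hu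
  have hD := hK.hess_le v hv.le
  have hg := hK.grad_le v hv.le
  have a1 : ⟪gradient f v, u - s⟫_ℝ ≤ K * (‖s‖ ^ 2 / 2) :=
    (real_inner_le_norm _ _).trans (mul_le_mul hg h3 (norm_nonneg _) hK0)
  have a2 : ⟪fderiv ℝ (gradient f) v u, u⟫_ℝ ≤ K * ‖u‖ * ‖u‖ :=
    (real_inner_le_norm _ _).trans (mul_le_mul_of_nonneg_right
      ((ContinuousLinearMap.le_opNorm _ _).trans (mul_le_mul_of_nonneg_right hD (norm_nonneg _)))
      (norm_nonneg _))
  have a3 : K * ‖u‖ ^ 2 ≤ K * ‖s‖ ^ 2 := by gcongr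
  have a4 : K * ‖u‖ ^ 3 ≤ K * ‖u‖ ^ 2 * 2 := by
    rw [pow_succ, ← mul_assoc]; gcongr
  rw [inner_sub_right] at a1
  nlinarith

/-- Positivity of the compression of `ambientHess` to the tangent space is stable. -/
theorem inner_ambientHess_ge (hK : TaylorBound f K) {m : ℝ} (hm : 0 ≤ m) {v w s : Vec n}
    (hv : ‖v‖ = 1) (hw : ‖w‖ = 1) (hs : ⟪v, s⟫_ℝ = 0)
    (hpos : ∀ p : Vec n, ⟪w, p⟫_ℝ = 0 → m * ‖p‖ ^ 2 ≤ ⟪ambientHess f w p, p⟫_ℝ) :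
    (m - (7 * K + 2 * m) * ‖v - w‖) * ‖s‖ ^ 2 ≤ ⟪ambientHess f v s, s⟫_ℝ := by
  have hK0 := hK.nonneg
  set r := ‖v - w‖ with hr
  have hr2 : r ≤ 2 := by
    refine (norm_sub_le _ _).trans ?_
    rw [hv, hw]; norm_num
  have hr0 : 0 ≤ r := norm_nonneg _
  -- The tangent spaces at v and w differ, so s is projected to the one at w; the removed component
  -- a is O(r‖s‖) because s ⊥ v.
  set a := ⟪w, s⟫_ℝ with ha
  have ha' : |a| ≤ r * ‖s‖ := by
    have : a = -⟪v - w, s⟫_ℝ := by rw [inner_sub_left, hs]; ring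
    rw [this, abs_neg]; exact abs_real_inner_le_norm _ _
  have hww : ⟪w, w⟫_ℝ = 1 := by rw [real_inner_self_eq_norm_sq, hw]; norm_num
  have hp : ⟪w, s - a • w⟫_ℝ = 0 := by
    rw [inner_sub_right, real_inner_smul_right, hww, ← ha]; ring
  have hpn : ‖s - a • w‖ ^ 2 = ‖s‖ ^ 2 - a ^ 2 := by
    rw [norm_sub_sq_real, real_inner_smul_right, real_inner_comm, ← ha, norm_smul, hw,
      Real.norm_eq_abs, mul_one, sq_abs]; ring
  have hpl : ‖s - a • w‖ ≤ ‖s‖ := by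
    refine (sq_le_sq₀ (norm_nonneg _) (norm_nonneg _)).1 ?_
    rw [hpn]; nlinarith [sq_nonneg a]
  have h1 := hpos _ hp
  rw [hpn] at h1
  set T := ambientHess f w
  have hT : ‖T‖ ≤ 2 * K := hK.norm_ambientHess_le hw
  have haw : ‖a • w‖ ≤ r * ‖s‖ := by rw [norm_smul, hw, mul_one]; exact ha'
  have e : ⟪ambientHess f v s, s⟫_ℝ = ⟪(ambientHess f v - T) s, s⟫_ℝ
      + ⟪T (a • w), s⟫_ℝ + ⟪T (s - a • w), a • w⟫_ℝ + ⟪T (s - a • w), s - a • w⟫_ℝ := by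
    simp only [sub_apply, map_sub, inner_sub_left, inner_sub_right]
    ring
  have b1 : |⟪(ambientHess f v - T) s, s⟫_ℝ| ≤ 3 * K * r * ‖s‖ * ‖s‖ :=
    (abs_real_inner_le_norm _ _).trans (mul_le_mul_of_nonneg_right
      ((ContinuousLinearMap.le_opNorm _ _).trans (mul_le_mul_of_nonneg_right
        (hK.norm_ambientHess_sub_le hv hw) (norm_nonneg _))) (norm_nonneg _))
  have b2 : |⟪T (a • w), s⟫_ℝ| ≤ 2 * K * (r * ‖s‖) * ‖s‖ :=
    (abs_real_inner_le_norm _ _).trans (mul_le_mul_of_nonneg_right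
      ((ContinuousLinearMap.le_opNorm _ _).trans (mul_le_mul hT haw (norm_nonneg _)
        (by positivity))) (norm_nonneg _))
  have b3 : |⟪T (s - a • w), a • w⟫_ℝ| ≤ 2 * K * ‖s‖ * (r * ‖s‖) :=
    (abs_real_inner_le_norm _ _).trans (mul_le_mul
      ((ContinuousLinearMap.le_opNorm _ _).trans (mul_le_mul hT hpl (norm_nonneg _)
        (by positivity))) haw (norm_nonneg _) (by positivity))
  have b4 : m * a ^ 2 ≤ m * (2 * r * ‖s‖ ^ 2) := by
    gcongr
    calc a ^ 2 = |a| ^ 2 := (sq_abs a).symm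
      _ ≤ (r * ‖s‖) ^ 2 := by gcongr
      _ = r * r * ‖s‖ ^ 2 := by ring
      _ ≤ 2 * r * ‖s‖ ^ 2 := by gcongr
  have c1 := (abs_le.1 b1).1
  have c2 := (abs_le.1 b2).1
  have c3 := (abs_le.1 b3).1
  rw [e]
  nlinarith

/-- The Newton equation at `v` holds for the tangential part of `w - v` up to second order, if
`w` is stationary. -/
theorem newton_residual_le (hK : TaylorBound f K) {v w t : Vec n} (hv : ‖v‖ = 1) (hw : ‖w‖ = 1)
    (hst : gradient f w = ⟪gradient f w, w⟫_ℝ • w) (ht : ⟪v, t⟫_ℝ = 0) :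
    |⟪gradient f v + ambientHess f v (w - ⟪v, w⟫_ℝ • v), t⟫_ℝ| ≤ 4 * K * ‖v - w‖ ^ 2 * ‖t‖ := by
  have hK0 := hK.nonneg
  have h1 := hK.grad_taylor v w hv.le hw.le
  have h2 := hK.abs_inner_gradient_self_sub_le hv hw
  rw [norm_sub_rev w v] at h1
  set r := ‖v - w‖ with hr
  set p := w - ⟪v, w⟫_ℝ • v with hp
  set D := fderiv ℝ (gradient f) v
  have hD : ‖D‖ ≤ K := hK.hess_le v hv.le
  set lam := ⟪gradient f w, w⟫_ℝ with hlam
  set μ := ⟪gradient f v, v⟫_ℝ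
  have hpn : ‖p‖ ≤ r := norm_sub_inner_smul_le hv hw
  have hepn : ‖w - v - p‖ = r ^ 2 / 2 := norm_sub_sub_sub_inner_smul hv hw
  have hpt : ⟪p, t⟫_ℝ = ⟪w, t⟫_ℝ := by
    rw [hp, inner_sub_left, real_inner_smul_left, ht]; ring
  -- By stationarity ∇f(w) acts on t as the multiplier `lam` times p. What remains is the Taylor
  -- error, the change of multiplier, and the radial part of w - v, each quadratic in r.
  have e : ⟪gradient f v + ambientHess f v p, t⟫_ℝ =
      -⟪gradient f w - gradient f v - D (w - v), t⟫_ℝ - (μ - lam) * ⟪p, t⟫_ℝ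
        - ⟪D (w - v - p), t⟫_ℝ := by
    have h5 : ⟪gradient f w, t⟫_ℝ = lam * ⟪p, t⟫_ℝ := by
      rw [hst, real_inner_smul_left, hpt]
    rw [ambientHess_apply, map_sub D (w - v) p]
    simp only [inner_sub_left, inner_add_left, real_inner_smul_left, h5]
    ring
  have b1 : |⟪gradient f w - gradient f v - D (w - v), t⟫_ℝ| ≤ K * r ^ 2 * ‖t‖ :=
    (abs_real_inner_le_norm _ _).trans (mul_le_mul_of_nonneg_right h1 (norm_nonneg _))
  have b2 : |(μ - lam) * ⟪p, t⟫_ℝ| ≤ 2 * K * r * (r * ‖t‖) := by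
    rw [abs_mul]
    exact mul_le_mul h2 ((abs_real_inner_le_norm _ _).trans
      (mul_le_mul_of_nonneg_right hpn (norm_nonneg _))) (abs_nonneg _) (by positivity)
  have b3 : |⟪D (w - v - p), t⟫_ℝ| ≤ K * (r ^ 2 / 2) * ‖t‖ :=
    (abs_real_inner_le_norm _ _).trans (mul_le_mul_of_nonneg_right
      ((D.le_opNorm _).trans (by rw [hepn]; gcongr)) (norm_nonneg _))
  have h6 : 0 ≤ K * r ^ 2 * ‖t‖ := by positivity
  rw [e]
  rw [abs_le] at *
  constructor <;> nlinarith

end TaylorBound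

theorem coe_riemGrad (f : Vec n → ℝ) {v : Vec n} (hv : ‖v‖ = 1) :
    (riemGrad f v : Vec n) = gradient f v - ⟪v, gradient f v⟫_ℝ • v := by
  rw [riemGrad, Submodule.orthogonalProjectionOnto_orthogonal,
    ← Submodule.starProjection_unit_singleton ℝ hv]

theorem TaylorBound.norm_riemHess_le {f : Vec n → ℝ} {K : ℝ} (hK : TaylorBound f K) {v : Vec n}
    (hv : ‖v‖ = 1) : ‖riemHess f v‖ ≤ 2 * K := by
  refine ContinuousLinearMap.opNorm_le_bound _ (by linarith [hK.nonneg]) fun s => ?_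
  change ‖(tangent v).orthogonalProjectionOnto (ambientHess f v (s : Vec n))‖ ≤ _
  refine (Submodule.norm_orthogonalProjectionOnto_apply_le _ _).trans ?_
  exact (ContinuousLinearMap.le_opNorm _ _).trans
    (mul_le_mul_of_nonneg_right (hK.norm_ambientHess_le hv) (norm_nonneg _))

/-! ### Descent steps and the local model -/

/-- A step of the quasi-Newton method for a general cost function `f`. -/
def IsDescentStep (f : Vec n → ℝ) (H : (v : Vec n) → (tangent v →L[ℝ] tangent v)) (τ β : ℝ)
    (x y : Vec n) : Prop :=
  ∃ (s : tangent x) (α : ℝ),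
    -(H x s) = riemGrad f x ∧
    IsGreatest {t : ℝ | ∃ j : ℕ, t = β ^ j ∧
      f (retr x (β ^ j • (s : Vec n))) ≤ f x + τ * β ^ j * ⟪riemGrad f x, s⟫_ℝ} α ∧
    y = retr x (α • (s : Vec n))

section Step

variable {f : Vec n → ℝ} {H : (v : Vec n) → (tangent v →L[ℝ] tangent v)} {τ β : ℝ} {x y : Vec n}

theorem IsDescentStep.norm_eq_one (h : IsDescentStep f H τ β x y) (hx : ‖x‖ = 1) : ‖y‖ = 1 := by
  obtain ⟨s, α, -, -, rfl⟩ := h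
  exact norm_retr hx (by rw [real_inner_smul_right, inner_of_tangent, mul_zero])

theorem IsDescentStep.le (h : IsDescentStep f H τ β x y) (hτ : 0 ≤ τ) (hβ : 0 ≤ β)
    (hH : (H x).IsPositive) : f y ≤ f x := by
  obtain ⟨s, α, hs, ⟨⟨j, rfl, hj⟩, -⟩, rfl⟩ := h
  refine hj.trans ?_
  have h1 : 0 ≤ ⟪H x s, s⟫_ℝ := hH.inner_nonneg_left s
  rw [← hs, inner_neg_left]
  have : 0 ≤ τ * β ^ j * ⟪H x s, s⟫_ℝ := by positivity
  linarith

end Step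

/-- Data near `w`: Taylor bounds for `f`, and operators `H v` close to the Riemannian Hessian,
uniformly positive definite. -/
structure LocalModel (f : Vec n → ℝ) (H : (v : Vec n) → (tangent v →L[ℝ] tangent v)) (w : Vec n)
    (K c E h ρ : ℝ) : Prop where
  taylor : TaylorBound f K
  norm_eq_one : ‖w‖ = 1
  c_nonneg : 0 ≤ c
  E_nonneg : 0 ≤ E
  h_pos : 0 < h
  ρ_pos : 0 < ρ
  approx : ∀ v, ‖v‖ = 1 → ‖v - w‖ < ρ → ‖riemHess f v - H v‖ ≤ c * ‖v - w‖ + E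
  coercive : ∀ v, ‖v‖ = 1 → ‖v - w‖ < ρ → ∀ s : tangent v, h * ‖s‖ ^ 2 ≤ ⟪H v s, s⟫_ℝ

/-- No continuity of H is assumed, so coercivity travels through the Hessian: from H(w) to Hess(w)
at cost E, to Hess(v) at cost O(‖v - w‖) by smoothness, and back to H(v) at cost E + c‖v - w‖. The
total loss is kept below h/2: the two copies of E take at most h/4, and the radius limits the rest
to h/4. -/
theorem exists_localModel {f : Vec n → ℝ} {H : (v : Vec n) → (tangent v →L[ℝ] tangent v)}
    {w : Vec n} {K c E h ρ : ℝ} (hK : TaylorBound f K) (hw : ‖w‖ = 1) (hc : 0 ≤ c) (hE : 0 ≤ E)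
    (hh : 0 < h) (hρ : 0 < ρ)
    (happ : ∀ v, ‖v‖ = 1 → ‖v - w‖ < ρ → ‖riemHess f v - H v‖ ≤ c * ‖v - w‖ + E)
    (hpos : ∀ s : tangent w, h * ‖s‖ ^ 2 ≤ ⟪H w s, s⟫_ℝ) (hEh : 8 * E ≤ h) :
    ∃ ρ', LocalModel f H w K c E (h / 2) ρ' := by
  have hK0 := hK.nonneg
  have key : ∀ v, ‖v‖ = 1 → ‖v - w‖ < ρ → ∀ s : tangent v,
      |⟪ambientHess f v (s : Vec n), (s : Vec n)⟫_ℝ - ⟪H v s, s⟫_ℝ|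
        ≤ (c * ‖v - w‖ + E) * ‖s‖ ^ 2 := by
    intro v hv hvw s
    rw [← inner_riemHess, ← inner_sub_left, ← sub_apply, pow_two, ← mul_assoc]
    exact (abs_real_inner_le_norm _ _).trans (mul_le_mul_of_nonneg_right
      ((ContinuousLinearMap.le_opNorm _ _).trans (mul_le_mul_of_nonneg_right (happ v hv hvw)
        (norm_nonneg _))) (norm_nonneg _))
  have hm : 0 ≤ h - E := by linarith
  have hposw : ∀ p : Vec n, ⟪w, p⟫_ℝ = 0 → (h - E) * ‖p‖ ^ 2 ≤ ⟪ambientHess f w p, p⟫_ℝ := by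
    intro p hp
    have h1 := hpos ⟨p, Submodule.mem_orthogonal_singleton_iff_inner_right.2 hp⟩
    have h2 := (abs_le.1 (key w hw (by simpa using hρ)
      ⟨p, Submodule.mem_orthogonal_singleton_iff_inner_right.2 hp⟩)).1
    simp only [sub_self, norm_zero, mul_zero, zero_add, Submodule.coe_norm] at h1 h2
    linarith
  set M := 7 * K + 2 * (h - E) + c with hM
  have hM0 : 0 ≤ M := by positivity
  refine ⟨min ρ (h / 4 / (M + 1)), hK, hw, hc, hE, by positivity, by positivity,
    fun v hv hvw => happ v hv (hvw.trans_le (min_le_left _ _)), fun v hv hvw s => ?_⟩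
  have h1 := hK.inner_ambientHess_ge hm hv hw (inner_of_tangent s) hposw
  have h2 := (abs_le.1 (key v hv (hvw.trans_le (min_le_left _ _)) s)).2
  have h3 : ‖v - w‖ * (M + 1) ≤ h / 4 :=
    (le_div_iff₀ (by linarith)).1 (hvw.le.trans (min_le_right _ _))
  have h4 : h / 2 ≤ (h - E) - (7 * K + 2 * (h - E)) * ‖v - w‖ - (c * ‖v - w‖ + E) := by
    have : 0 ≤ ‖v - w‖ := norm_nonneg _
    rw [hM] at h3
    nlinarith
  have h5 := mul_le_mul_of_nonneg_right h4 (sq_nonneg ‖s‖)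
  rw [Submodule.coe_norm] at *
  nlinarith

/-! ### Stationarity of cluster points and contraction of the full step -/

namespace LocalModel

variable {f : Vec n → ℝ} {H : (v : Vec n) → (tangent v →L[ℝ] tangent v)} {w : Vec n}
  {K c E h ρ τ β : ℝ}

theorem inner_gradient_eq {x : Vec n} {s : tangent x} (hs : -(H x s) = riemGrad f x)
    (t : tangent x) : ⟪gradient f x, (t : Vec n)⟫_ℝ = -⟪H x s, t⟫_ℝ := by
  rw [← inner_riemGrad, ← hs, inner_neg_left]

/-- Near `w`, a step decreases `f` by at least a fixed multiple of the squared gradient norm. -/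
theorem exists_decrease (hL : LocalModel f H w K c E h ρ) (hτ : 0 < τ) (hτ' : τ < 1)
    (hβ : 0 < β) (hβ' : β < 1) :
    ∃ η > 0, ∀ x y, ‖x‖ = 1 → ‖x - w‖ < ρ → IsDescentStep f H τ β x y →
      f y ≤ f x - η * ‖riemGrad f x‖ ^ 2 := by
  have hK0 := hL.taylor.nonneg
  have hc := hL.c_nonneg
  have hE := hL.E_nonneg
  have hh := hL.h_pos
  have hρ := hL.ρ_pos
  have hτ1 : 0 < 1 - τ := by linarith
  -- The exponent J is chosen so that β^J passes the decrease test at every point near w; by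
  -- maximality the accepted step size is never smaller.
  obtain ⟨J, hJ⟩ := exists_pow_lt_of_lt_one
    (show 0 < (1 - τ) * h / (4 * K + 1) by positivity) hβ'
  rw [lt_div_iff₀ (by positivity)] at hJ
  -- L bounds ‖H x‖ on the ball, so ‖grad‖ ≤ L‖s‖ converts decrease in ‖s‖² into decrease in
  -- ‖grad‖².
  set L := 2 * K + c * ρ + E + 1 with hLdef
  have hL0 : 0 < L := by positivity
  have hb : 0 < β ^ J := by positivity
  refine ⟨τ * β ^ J * h / L ^ 2, by positivity, fun x y hx hxw hstep => ?_⟩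
  obtain ⟨s, α, hs, ⟨⟨j, rfl, hj⟩, hmax⟩, rfl⟩ := hstep
  have hq := hL.coercive x hx hxw s
  have hin : ⟪riemGrad f x, s⟫_ℝ = -⟪H x s, s⟫_ℝ := by rw [← hs, inner_neg_left]
  have hJmem : β ^ J ≤ β ^ j := by
    refine hmax ⟨J, rfl, ?_⟩
    have h1 := hL.taylor.retr_le hx (s := β ^ J • (s : Vec n))
      (by rw [real_inner_smul_right, inner_of_tangent, mul_zero])
    rw [real_inner_smul_right, inner_gradient_eq hs, norm_smul, Real.norm_of_nonneg hb.le,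
      ← Submodule.coe_norm] at h1
    rw [hin]
    refine h1.trans ?_
    have h2 : 4 * K * β ^ J * ‖s‖ ^ 2 ≤ (1 - τ) * ⟪H x s, s⟫_ℝ := by
      calc 4 * K * β ^ J * ‖s‖ ^ 2 ≤ (1 - τ) * h * ‖s‖ ^ 2 := by
            have : 4 * K * β ^ J ≤ (1 - τ) * h := by linarith
            gcongr
        _ = (1 - τ) * (h * ‖s‖ ^ 2) := by ring
        _ ≤ _ := by gcongr
    have h3 := mul_le_mul_of_nonneg_left h2 hb.le
    nlinarith
  have hHn : ‖riemGrad f x‖ ≤ L * ‖s‖ := by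
    rw [← hs, norm_neg]
    refine (ContinuousLinearMap.le_opNorm _ _).trans ?_
    gcongr
    have h1 := hL.taylor.norm_riemHess_le hx
    have h2 := hL.approx x hx hxw
    have h3 : ‖H x‖ ≤ ‖riemHess f x‖ + ‖riemHess f x - H x‖ := by
      have := norm_sub_le (riemHess f x) (riemHess f x - H x)
      rwa [sub_sub_cancel] at this
    have h4 : c * ‖x - w‖ ≤ c * ρ := by gcongr
    linarith
  refine hj.trans ?_
  rw [hin]
  have h5 : τ * β ^ J * h / L ^ 2 * ‖riemGrad f x‖ ^ 2 ≤ τ * β ^ j * ⟪H x s, s⟫_ℝ := by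
    calc τ * β ^ J * h / L ^ 2 * ‖riemGrad f x‖ ^ 2
        ≤ τ * β ^ J * h / L ^ 2 * (L * ‖s‖) ^ 2 := by gcongr
      _ = τ * β ^ J * (h * ‖s‖ ^ 2) := by field_simp
      _ ≤ τ * β ^ j * ⟪H x s, s⟫_ℝ := by gcongr
  linarith

/-- Cluster points of the iteration are stationary. -/
theorem gradient_eq (hL : LocalModel f H w K c E h ρ) (hf : Continuous f)
    (hg : Continuous (gradient f)) (hτ : 0 < τ) (hτ' : τ < 1)
    (hβ : 0 < β) (hβ' : β < 1) {v : ℕ → Vec n} (hv : ∀ k, ‖v k‖ = 1)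
    (hstep : ∀ k, IsDescentStep f H τ β (v k) (v (k + 1)))
    (hH : ∀ k, (H (v k)).IsPositive) (hcl : MapClusterPt w atTop v) :
    gradient f w = ⟪gradient f w, w⟫_ℝ • w := by
  obtain ⟨η, hη, hdec⟩ := hL.exists_decrease hτ hτ' hβ hβ'
  have hanti : Antitone fun k => f (v k) :=
    antitone_nat_of_succ_le fun k => (hstep k).le hτ.le hβ.le (hH k)
  have hge : ∀ k, f w ≤ f (v k) := by
    intro k
    by_contra! hlt
    have h1 : ∀ᶠ z in 𝓝 w, f (v k) < f z := hf.continuousAt.eventually (lt_mem_nhds hlt)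
    obtain ⟨j, hj, hj'⟩ := frequently_atTop.1 (hcl.frequently h1) k
    exact absurd (hanti hj) (not_le.2 hj')
  by_contra hne
  -- The Riemannian gradient as a map into the fixed space, so that continuity in the base point
  -- makes sense.
  set G : Vec n → Vec n := fun x => gradient f x - ⟪x, gradient f x⟫_ℝ • x with hG
  have hGc : Continuous G := by fun_prop
  have hGw : 0 < ‖G w‖ := by
    rw [norm_pos_iff, hG]
    intro h0
    exact hne (by rw [real_inner_comm]; exact sub_eq_zero.1 h0)
  -- From such a z near w, one step would bring the cost below f w, contradicting `hge`.
  have hΦ : ∀ᶠ z in 𝓝 w, f z - η * ‖G z‖ ^ 2 < f w := by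
    have hc : Continuous fun z => f z - η * ‖G z‖ ^ 2 := by fun_prop
    refine hc.continuousAt.eventually (gt_mem_nhds ?_)
    have : 0 < η * ‖G w‖ ^ 2 := by positivity
    linarith
  have hball : ∀ᶠ z in 𝓝 w, ‖z - w‖ < ρ := by
    filter_upwards [Metric.ball_mem_nhds w hL.ρ_pos] with z hz
    rwa [mem_ball_iff_norm] at hz
  obtain ⟨k, hk1, hk2⟩ := (hcl.frequently (hΦ.and hball)).exists
  have h1 := hdec _ _ (hv k) hk2 (hstep k)
  rw [Submodule.coe_norm, coe_riemGrad f (hv k)] at h1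
  exact absurd (hge (k + 1)) (not_le.2 (h1.trans_lt hk1))

/-- The quasi-Newton direction at `x` agrees with the tangential part of `w - x` up to an error
that is linear in the Hessian error, and quadratic otherwise. -/
theorem norm_direction_sub_le (hL : LocalModel f H w K c E h ρ)
    (hst : gradient f w = ⟪gradient f w, w⟫_ℝ • w) {x : Vec n} (hx : ‖x‖ = 1)
    (hxw : ‖x - w‖ < ρ) {s p : tangent x} (hs : -(H x s) = riemGrad f x)
    (hp : (p : Vec n) = w - ⟪x, w⟫_ℝ • x) :
    ‖s - p‖ ≤ E / h * ‖x - w‖ + (4 * K + c) / h * ‖x - w‖ ^ 2 := by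
  have hK0 := hL.taylor.nonneg
  have hc := hL.c_nonneg
  have hE0 := hL.E_nonneg
  have hh := hL.h_pos
  have hw := hL.norm_eq_one
  have happ := hL.approx x hx hxw
  have hpn : ‖p‖ ≤ ‖x - w‖ := by
    rw [Submodule.coe_norm, hp]; exact norm_sub_inner_smul_le hx hw
  have hres := (abs_le.1 (hL.taylor.newton_residual_le hx hw hst (inner_of_tangent (s - p)))).1
  have h1 := hL.coercive x hx hxw (s - p)
  -- Since H s = -grad, this splits into the residual of p in the exact Newton equation and the
  -- Hessian error applied to p.
  have h2 : ⟪H x (s - p), s - p⟫_ℝ =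
      -⟪gradient f x + ambientHess f x (p : Vec n), ((s - p : tangent x) : Vec n)⟫_ℝ
      + ⟪(riemHess f x - H x) p, s - p⟫_ℝ := by
    rw [inner_add_left, inner_gradient_eq hs, ← inner_riemHess, sub_apply, inner_sub_left,
      map_sub, inner_sub_left (H x s) (H x p)]
    ring
  rw [← hp, ← Submodule.coe_norm] at hres
  have h3 : ⟪(riemHess f x - H x) p, s - p⟫_ℝ ≤ (c * ‖x - w‖ + E) * ‖x - w‖ * ‖s - p‖ :=
    (real_inner_le_norm _ _).trans (mul_le_mul_of_nonneg_right
      ((ContinuousLinearMap.le_opNorm _ _).trans (mul_le_mul happ hpn (norm_nonneg _)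
        (by positivity))) (norm_nonneg _))
  generalize ‖x - w‖ = r at *
  have hr0 : 0 ≤ r := (norm_nonneg _).trans hpn
  have h4 : h * ‖s - p‖ ^ 2 ≤ (E * r + (4 * K + c) * r ^ 2) * ‖s - p‖ := by linarith
  have h5 : E / h * r + (4 * K + c) / h * r ^ 2 = (E * r + (4 * K + c) * r ^ 2) / h := by
    field_simp
  rw [h5, le_div_iff₀ hh]
  rcases (norm_nonneg (s - p)).eq_or_lt with h0 | h0
  · rw [← h0, zero_mul]; positivity
  · refine le_of_mul_le_mul_right ?_ h0
    linarith

/-- The full step satisfies the sufficient decrease condition if the direction is short. -/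
theorem full_step_accepted (hL : LocalModel f H w K c E h ρ) (hτ' : τ < 1 / 2)
    {x : Vec n} (hx : ‖x‖ = 1) (hxw : ‖x - w‖ < ρ) {s : tangent x}
    (hs : -(H x s) = riemGrad f x)
    (hsmall : (c * ‖x - w‖ + E) / 2 + 4 * K * ‖s‖ ≤ (1 / 2 - τ) * h) :
    f (retr x (s : Vec n)) ≤ f x + τ * ⟪riemGrad f x, s⟫_ℝ := by
  have hτ1 : 0 < 1 / 2 - τ := by linarith
  have happ := hL.approx x hx hxw
  have hq := hL.coercive x hx hxw s
  have h1 := (abs_le.1 (hL.taylor.retr_expansion hx (inner_of_tangent s))).2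
  rw [inner_gradient_eq hs, ← inner_riemHess, ← Submodule.coe_norm] at h1
  have h2 : ⟪riemHess f x s, s⟫_ℝ - ⟪H x s, s⟫_ℝ ≤ (c * ‖x - w‖ + E) * ‖s‖ ^ 2 := by
    rw [← inner_sub_left, ← sub_apply, pow_two, ← mul_assoc]
    exact (real_inner_le_norm _ _).trans (mul_le_mul_of_nonneg_right
      ((ContinuousLinearMap.le_opNorm _ _).trans (mul_le_mul_of_nonneg_right happ
        (norm_nonneg _))) (norm_nonneg _))
  -- The model gives a decrease of ⟨Hs,s⟩/2 up to these errors; the slack (1/2 - τ)⟨Hs,s⟩ left by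
  -- the test must absorb them.
  have h4 : ((c * ‖x - w‖ + E) / 2 + 4 * K * ‖s‖) * ‖s‖ ^ 2 ≤ (1 / 2 - τ) * ⟪H x s, s⟫_ℝ := by
    calc _ ≤ (1 / 2 - τ) * h * ‖s‖ ^ 2 := by gcongr
      _ = (1 / 2 - τ) * (h * ‖s‖ ^ 2) := by ring
      _ ≤ _ := by gcongr
  rw [← hs, inner_neg_left]
  linarith

/-- Near a stationary point `w`, the full step is accepted, and it contracts the distance to
`w`. -/
theorem exists_newton_step_le (hL : LocalModel f H w K c E h ρ) (hβ : 0 ≤ β) (hβ' : β ≤ 1)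
    (hst : gradient f w = ⟪gradient f w, w⟫_ℝ • w) (hτ : 0 < τ) (hτ' : τ < 1 / 2)
    (hE : 4 * E ≤ (1 / 2 - τ) * h) :
    ∃ ρ' > 0, ∃ K', 0 ≤ K' ∧ ∀ x y, ‖x‖ = 1 → ‖x - w‖ < ρ' → IsDescentStep f H τ β x y →
      ‖y - w‖ ≤ E / h * ‖x - w‖ + K' * ‖x - w‖ ^ 2 := by
  have hK0 := hL.taylor.nonneg
  have hc := hL.c_nonneg
  have hE0 := hL.E_nonneg
  have hh := hL.h_pos
  have hρ := hL.ρ_pos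
  have hw := hL.norm_eq_one
  have hτ1 : 0 < 1 / 2 - τ := by linarith
  obtain ⟨K₁, hK₁⟩ : ∃ K₁, K₁ = (4 * K + c) / h := ⟨_, rfl⟩
  have hK₁0 : 0 ≤ K₁ := by rw [hK₁]; positivity
  have hEh : E / h ≤ 1 := by
    rw [div_le_one hh]; nlinarith
  -- The second radius makes the direction error at most 2r, hence ‖s‖ ≤ 3r; the third makes the
  -- full step acceptable. In K₁ + 5, the 5 is 9/2 from the retraction error (3r)²/2 plus 1/2 from
  -- the radial part of w - x.
  refine ⟨min ρ (min (1 / (K₁ + 1)) ((1 / 2 - τ) * h / (2 * (c + 12 * K + 1)))), by positivity,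
    K₁ + 5, by positivity, fun x y hx hxw hstep => ?_⟩
  obtain ⟨s, α, hs, ⟨⟨j, rfl, hj⟩, hmax⟩, rfl⟩ := hstep
  rw [lt_min_iff, lt_min_iff, lt_div_iff₀ (by positivity), lt_div_iff₀ (by positivity)] at hxw
  obtain ⟨hr1, hr2, hr3⟩ := hxw
  have hr0 : 0 ≤ ‖x - w‖ := norm_nonneg _
  have hp0 : ⟪x, w - ⟪x, w⟫_ℝ • x⟫_ℝ = 0 := by
    rw [inner_sub_right, real_inner_smul_right, real_inner_self_eq_norm_sq, hx]; ring
  obtain ⟨p, hp⟩ : ∃ p : tangent x, (p : Vec n) = w - ⟪x, w⟫_ℝ • x :=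
    ⟨⟨_, Submodule.mem_orthogonal_singleton_iff_inner_right.2 hp0⟩, rfl⟩
  have hpn : ‖p‖ ≤ ‖x - w‖ := by
    rw [Submodule.coe_norm, hp]; exact norm_sub_inner_smul_le hx hw
  have hpe : ‖w - x - (p : Vec n)‖ = ‖x - w‖ ^ 2 / 2 := by
    rw [hp]; exact norm_sub_sub_sub_inner_smul hx hw
  have htn := hL.norm_direction_sub_le hst hx hr1 hs hp
  rw [← hK₁] at htn
  have htr : ‖s - p‖ ≤ 2 * ‖x - w‖ := by
    have h1 : E / h * ‖x - w‖ ≤ 1 * ‖x - w‖ := mul_le_mul_of_nonneg_right hEh hr0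
    have h2 : K₁ * ‖x - w‖ ^ 2 ≤ 1 * ‖x - w‖ := by
      rw [pow_two, ← mul_assoc]
      exact mul_le_mul_of_nonneg_right (by linarith) hr0
    linarith
  have hsn : ‖s‖ ≤ 3 * ‖x - w‖ := by
    have := norm_add_le (s - p) p
    rw [sub_add_cancel] at this
    linarith
  have hone : β ^ j = 1 := by
    refine le_antisymm (pow_le_one₀ hβ hβ') (hmax ⟨0, by simp, ?_⟩)
    rw [pow_zero, one_smul, mul_one]
    refine hL.full_step_accepted hτ' hx hr1 hs ?_
    have h1 : 4 * K * ‖s‖ ≤ 4 * K * (3 * ‖x - w‖) :=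
      mul_le_mul_of_nonneg_left hsn (by positivity)
    nlinarith [mul_nonneg hc hr0, mul_nonneg hK0 hr0]
  rw [hone, one_smul]
  have e : retr x (s : Vec n) - w =
      (retr x (s : Vec n) - x - s) + ((s - p : tangent x) : Vec n) - (w - x - (p : Vec n)) := by
    rw [Submodule.coe_sub]; abel
  have h1 := norm_retr_sub_sub_le hx (inner_of_tangent s)
  rw [← Submodule.coe_norm s] at h1
  have h2 : ‖s‖ ^ 2 ≤ (3 * ‖x - w‖) ^ 2 := pow_le_pow_left₀ (norm_nonneg _) hsn 2
  rw [e]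
  have h3 := norm_sub_le ((retr x (s : Vec n) - x - s) + ((s - p : tangent x) : Vec n))
    (w - x - (p : Vec n))
  have h4 := norm_add_le (retr x (s : Vec n) - x - s) ((s - p : tangent x) : Vec n)
  rw [Submodule.coe_norm (s - p)] at htn
  linarith

/-- Local convergence of the iteration to its cluster point. -/
theorem tendsto_and_rate (hL : LocalModel f H w K c E h ρ) (hf : Continuous f)
    (hg : Continuous (gradient f)) (hτ : 0 < τ) (hτ' : τ < 1 / 2)
    (hβ : 0 < β) (hβ' : β < 1) {v : ℕ → Vec n} (hv : ∀ k, ‖v k‖ = 1)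
    (hstep : ∀ k, IsDescentStep f H τ β (v k) (v (k + 1)))
    (hH : ∀ k, (H (v k)).IsPositive) (hcl : MapClusterPt w atTop v)
    (hE : 4 * E ≤ (1 / 2 - τ) * h) :
    Tendsto v atTop (𝓝 w) ∧ ∃ K', 0 ≤ K' ∧ ∀ᶠ k in atTop,
      ‖v (k + 1) - w‖ ≤ E / h * ‖v k - w‖ + K' * ‖v k - w‖ ^ 2 := by
  have hst := hL.gradient_eq hf hg hτ (by linarith) hβ hβ' hv hstep hH hcl
  obtain ⟨ρ', hρ', K', hK', hN⟩ := hL.exists_newton_step_le hβ.le hβ'.le hst hτ hτ' hE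
  have hEh : E / h ≤ 1 / 4 := by
    rw [div_le_iff₀ hL.h_pos]; nlinarith [hL.h_pos]
  -- On this ball the linear and quadratic terms each contribute a factor at most 1/4, so the ball
  -- is invariant and distances halve.
  set ρ₂ := min ρ' (1 / (4 * (K' + 1))) with hρ₂
  have hρ₂0 : 0 < ρ₂ := by positivity
  have hhalf : ∀ k, ‖v k - w‖ < ρ₂ → ‖v (k + 1) - w‖ ≤ 1 / 2 * ‖v k - w‖ := by
    intro k hk
    rw [hρ₂, lt_min_iff, lt_div_iff₀ (by positivity)] at hk
    refine (hN _ _ (hv k) hk.1 (hstep k)).trans ?_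
    have h0 := norm_nonneg (v k - w)
    have h1 : E / h * ‖v k - w‖ ≤ 1 / 4 * ‖v k - w‖ := by gcongr
    have h2 : K' * ‖v k - w‖ ^ 2 ≤ 1 / 4 * ‖v k - w‖ := by
      rw [pow_two, ← mul_assoc]
      gcongr
      linarith
    linarith
  have hball : ∀ᶠ z in 𝓝 w, ‖z - w‖ < ρ₂ := by
    filter_upwards [Metric.ball_mem_nhds w hρ₂0] with z hz
    rwa [mem_ball_iff_norm] at hz
  obtain ⟨k₀, hk₀⟩ := (hcl.frequently hball).exists
  have hind : ∀ j, ‖v (j + k₀) - w‖ ≤ (1 / 2) ^ j * ρ₂ ∧ ‖v (j + k₀) - w‖ < ρ₂ := by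
    intro j
    induction j with
    | zero => simpa using ⟨hk₀.le, hk₀⟩
    | succ j ih =>
      have h1 := hhalf _ ih.2
      rw [show j + 1 + k₀ = j + k₀ + 1 by ring]
      constructor
      · rw [pow_succ]; linarith [ih.1]
      · linarith [ih.2, norm_nonneg (v (j + k₀) - w)]
  have htend : Tendsto v atTop (𝓝 w) := by
    rw [← tendsto_add_atTop_iff_nat k₀, tendsto_iff_norm_sub_tendsto_zero]
    refine squeeze_zero (fun _ => norm_nonneg _) (fun j => (hind j).1) ?_
    simpa using (tendsto_pow_atTop_nhds_zero_of_lt_one (r := (1 / 2 : ℝ)) (by norm_num)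
      (by norm_num)).mul_const ρ₂
  refine ⟨htend, K', hK', ?_⟩
  filter_upwards [htend.eventually hball] with k hk
  exact hN _ _ (hv k) (hk.trans_le (min_le_left _ _)) (hstep k)

end LocalModel

/-! ### The reduced cost, the inverse bound and geodesic distance -/

theorem contDiff_redCost (A B : Matrix (Fin n) (Fin n) ℝ) {k : WithTop ℕ∞} :
    ContDiff ℝ k (redCost A B) := by
  have h : ∀ M : Matrix (Fin n) (Fin n) ℝ, ContDiff ℝ k fun v : Vec n => act M v :=
    fun M => (act M).contDiff
  unfold redCost cost
  exact (((h A).sub ((contDiff_id.inner ℝ (h A)).smul contDiff_id)).norm_sq ℝ).add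
    (((h B).sub ((contDiff_id.inner ℝ (h B)).smul contDiff_id)).norm_sq ℝ)

/-- A positive operator with inverse of norm at most `κ` is bounded below by `κ⁻¹`. -/
theorem inner_ge_of_norm_inverse_le {W : Type*} [NormedAddCommGroup W] [InnerProductSpace ℝ W]
    {T : W →L[ℝ] W} (hT : T.IsPositive) (hu : IsUnit T) {κ : ℝ} (hκ : 0 < κ)
    (hinv : ‖Ring.inverse T‖ ≤ κ) (s : W) : κ⁻¹ * ‖s‖ ^ 2 ≤ ⟪T s, s⟫_ℝ := by
  set y := Ring.inverse T s with hy
  have hTy : T y = s := by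
    rw [hy, ← mul_apply_eq_comp, Ring.mul_inverse_cancel T hu,
      one_apply_eq_self]
  -- Testing positivity on s - κ⁻¹ T⁻¹s yields the lower bound directly, without spectral theory.
  have h0 := hT.inner_nonneg_left (s - κ⁻¹ • y)
  have h1 : ⟪T s, y⟫_ℝ = ‖s‖ ^ 2 := by
    rw [hT.inner_left_eq_inner_right, hTy, real_inner_self_eq_norm_sq]
  have h2 : ⟪s, y⟫_ℝ ≤ κ * ‖s‖ ^ 2 := by
    calc ⟪s, y⟫_ℝ ≤ ‖s‖ * ‖y‖ := real_inner_le_norm _ _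
      _ ≤ ‖s‖ * (κ * ‖s‖) := by
        gcongr
        exact (ContinuousLinearMap.le_opNorm _ _).trans
          (mul_le_mul_of_nonneg_right hinv (norm_nonneg _))
      _ = _ := by ring
  have h3 : ⟪T (s - κ⁻¹ • y), s - κ⁻¹ • y⟫_ℝ =
      ⟪T s, s⟫_ℝ - 2 * κ⁻¹ * ‖s‖ ^ 2 + κ⁻¹ * (κ⁻¹ * ⟪s, y⟫_ℝ) := by
    rw [map_sub, map_smul, hTy]
    simp only [inner_sub_left, inner_sub_right, real_inner_smul_left, real_inner_smul_right,
      real_inner_self_eq_norm_sq, h1]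
    ring
  have h4 : κ⁻¹ * (κ⁻¹ * ⟪s, y⟫_ℝ) ≤ κ⁻¹ * ‖s‖ ^ 2 := by
    refine mul_le_mul_of_nonneg_left ?_ (by positivity)
    rw [inv_mul_le_iff₀ hκ]; exact h2
  linarith

/-- With θ the arc, the squared chord is 2 - 2 cos θ, so this is 1 - θ²/2 ≤ cos θ; the reverse
comparison uses cos θ ≤ 1 - 2θ²/π² on [0, π]. -/
theorem norm_sub_le_sphereDist {v w : Vec n} (hv : ‖v‖ = 1) (hw : ‖w‖ = 1) :
    ‖v - w‖ ≤ sphereDist v w := by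
  have h1 : ‖v - w‖ ^ 2 = 2 - 2 * ⟪v, w⟫_ℝ := by
    rw [norm_sub_sq_real, hv, hw]; ring
  have h2 := abs_le.1 (abs_real_inner_le_norm v w)
  rw [hv, hw, mul_one] at h2
  refine (sq_le_sq₀ (norm_nonneg _) (Real.arccos_nonneg _)).1 ?_
  have h3 := Real.one_sub_sq_div_two_le_cos (x := Real.arccos ⟪v, w⟫_ℝ)
  rw [Real.cos_arccos h2.1 h2.2] at h3
  linarith

theorem sphereDist_le {v w : Vec n} (hv : ‖v‖ = 1) (hw : ‖w‖ = 1) :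
    sphereDist v w ≤ Real.pi / 2 * ‖v - w‖ := by
  have h1 : ‖v - w‖ ^ 2 = 2 - 2 * ⟪v, w⟫_ℝ := by
    rw [norm_sub_sq_real, hv, hw]; ring
  have h2 := abs_le.1 (abs_real_inner_le_norm v w)
  rw [hv, hw, mul_one] at h2
  have hpi := Real.pi_pos
  refine (sq_le_sq₀ (Real.arccos_nonneg _) (by positivity)).1 ?_
  have h3 := Real.cos_le_one_sub_mul_cos_sq (x := Real.arccos ⟪v, w⟫_ℝ)
    (by rw [abs_of_nonneg (Real.arccos_nonneg _)]; exact Real.arccos_le_pi _)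
  rw [Real.cos_arccos h2.1 h2.2] at h3
  rw [mul_pow, h1]
  have h4 : 2 / Real.pi ^ 2 * Real.arccos ⟪v, w⟫_ℝ ^ 2 ≤ 1 - ⟪v, w⟫_ℝ := by linarith
  rw [div_mul_eq_mul_div, div_le_iff₀ (by positivity)] at h4
  linarith

/-- Local convergence of the quasi-Newton method, in terms of the bound `E` for the Hessian error
at the cluster point. -/
theorem IsQuasiNewtonRun.tendsto_and_rate {A B ΔA ΔB : Matrix (Fin n) (Fin n) ℝ}
    {H : (v : Vec n) → (tangent v →L[ℝ] tangent v)} {τ β κ C₁ : ℝ} {v : ℕ → Vec n} {vs : Vec n}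
    (hτ : τ ∈ Set.Ioo (0 : ℝ) (1 / 2)) (hβ : β ∈ Set.Ioo (0 : ℝ) 1)
    (hH : ∀ w : Vec n, ‖w‖ = 1 → (H w).IsPositive) (hrun : IsQuasiNewtonRun A B H τ β v)
    (hcl : MapClusterPt vs atTop v) (hest : HessianEstimate C₁ A B ΔA ΔB H vs)
    (hunit : IsUnit (H vs)) (hκ : 0 < κ) (hinv : ‖Ring.inverse (H vs)‖ ≤ κ) (hC₁ : 0 ≤ C₁)
    (hE : 8 * κ * (C₁ * (‖ΔA‖ + ‖ΔB‖)) ≤ 1 / 2 - τ) :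
    ‖vs‖ = 1 ∧ Tendsto v atTop (𝓝 vs) ∧ ∃ Q, 0 ≤ Q ∧ ∀ᶠ k in atTop, sphereDist (v (k + 1)) vs ≤
      4 * κ * (C₁ * (‖ΔA‖ + ‖ΔB‖)) * sphereDist (v k) vs + Q * sphereDist (v k) vs ^ 2 := by
  have hv : ∀ k, ‖v k‖ = 1 := by
    intro k
    induction k with
    | zero => exact hrun.1
    -- `IsQuasiNewtonStep A B` is by definition `IsDescentStep` for `redCost A B`.
    | succ k ih => exact IsDescentStep.norm_eq_one (hrun.2 k) ih
  have hvs : ‖vs‖ = 1 := by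
    by_contra hne
    have h1 : ∀ᶠ z in 𝓝 vs, ‖z‖ ≠ 1 := continuous_norm.continuousAt.eventually_ne hne
    obtain ⟨k, hk⟩ := (hcl.frequently h1).exists
    exact hk (hv k)
  obtain ⟨c, hc⟩ := hest
  obtain ⟨E, hEdef⟩ : ∃ E, E = C₁ * (‖ΔA‖ + ‖ΔB‖) := ⟨_, rfl⟩
  rw [← hEdef] at hE hc ⊢
  have hE0 : 0 ≤ E := by rw [hEdef]; positivity
  obtain ⟨ρ, hρ, hball⟩ := Metric.mem_nhdsWithin_iff.1 hc
  obtain ⟨K, hK⟩ := exists_taylorBound (contDiff_redCost A B)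
  have hκE : 8 * E ≤ (1 / 2 - τ) * κ⁻¹ := by
    rw [← div_eq_mul_inv, le_div_iff₀ hκ]; linarith
  have hκ' : 0 < κ⁻¹ := by positivity
  obtain ⟨ρ', hL⟩ := exists_localModel (H := H) (c := |c|) (h := κ⁻¹) (ρ := ρ) hK hvs (abs_nonneg c)
    hE0 hκ' hρ (fun w hw hwv => by
      refine (hball ⟨by rwa [mem_ball_iff_norm], by simpa using hw⟩).trans ?_
      gcongr
      exact le_abs_self c)
    (inner_ge_of_norm_inverse_le (hH vs hvs) hunit hκ hinv) (by nlinarith [hτ.1])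
  obtain ⟨htend, K', hK', hrate⟩ := hL.tendsto_and_rate (contDiff_redCost A B (k := 1)).continuous
    (contDiff_gradient (m := 0) (contDiff_redCost A B (k := 1)) (by norm_num)).continuous
    hτ.1 hτ.2 hβ.1 hβ.2 hv hrun.2 (fun k => hH _ (hv k)) hcl (by linarith)
  refine ⟨hvs, htend, Real.pi / 2 * K', by positivity, ?_⟩
  filter_upwards [hrate] with k hk
  have h1 := norm_sub_le_sphereDist (hv k) hvs
  have h2 := sphereDist_le (hv (k + 1)) hvs
  -- The local coercivity constant is κ⁻¹/2, giving the chordal rate 2κE; passing to arcs costs π/2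
  -- ≤ 2, hence 4κE.
  have h3 : E / (κ⁻¹ / 2) = 2 * κ * E := by field_simp
  rw [h3] at hk
  have h4 : Real.pi / 2 ≤ 2 := by linarith [Real.pi_le_four]
  calc sphereDist (v (k + 1)) vs ≤ Real.pi / 2 * ‖v (k + 1) - vs‖ := h2
    _ ≤ Real.pi / 2 * (2 * κ * E * ‖v k - vs‖ + K' * ‖v k - vs‖ ^ 2) := by gcongr
    _ = Real.pi / 2 * (2 * κ * E) * ‖v k - vs‖ + Real.pi / 2 * K' * ‖v k - vs‖ ^ 2 := by ring
    _ ≤ 2 * (2 * κ * E) * sphereDist (v k) vs + Real.pi / 2 * K' * sphereDist (v k) vs ^ 2 := by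
      gcongr
    _ = _ := by ring

theorem tendsto_sphereDist {v : ℕ → Vec n} {w : Vec n} (hw : ‖w‖ = 1)
    (hv : Tendsto v atTop (𝓝 w)) : Tendsto (fun k => sphereDist (v k) w) atTop (𝓝 0) := by
  have hc : Continuous fun x : Vec n => sphereDist x w :=
    Real.continuous_arccos.comp (continuous_id.inner continuous_const)
  have h0 : sphereDist w w = 0 := by
    rw [sphereDist, real_inner_self_eq_norm_sq, hw, one_pow, Real.arccos_one]
  exact h0 ▸ (hc.tendsto w).comp hv

end SphereQN

theorem theorem4p1 :
    ∀ C₀ > (0 : ℝ), ∀ C₁ > (0 : ℝ), ∀ κ > (0 : ℝ), ∃ C > (0 : ℝ),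
    ∀ τ ∈ Set.Ioo (0 : ℝ) (1 / 2), ∃ δ > (0 : ℝ),
    ∀ (n : ℕ) (A B As Bs ΔA ΔB : Matrix (Fin n) (Fin n) ℝ)
      (H : (v : SphereQN.Vec n) → (SphereQN.tangent v →L[ℝ] SphereQN.tangent v))
      (β : ℝ) (v : ℕ → SphereQN.Vec n) (vs : SphereQN.Vec n),
      A.IsSymm → B.IsSymm →
      SphereQN.IsAlmostCommutingDecomp C₀ A B As Bs ΔA ΔB →
      β ∈ Set.Ioo (0 : ℝ) 1 →
      (∀ w : SphereQN.Vec n, ‖w‖ = 1 → (H w).IsPositive) →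
      SphereQN.IsQuasiNewtonRun A B H τ β v →
      MapClusterPt vs atTop v →
      SphereQN.HessianEstimate C₁ A B ΔA ΔB H vs →
      (∀ k, IsUnit (H (v k))) →
      IsUnit (H vs) →
      (A * B - B * A ≠ 0 → ‖A * B - B * A‖ < δ → ‖Ring.inverse (H vs)‖ ≤ κ →
        Tendsto v atTop (𝓝 vs) ∧
        C * √‖A * B - B * A‖ < 1 ∧
        ∀ᶠ k in atTop, SphereQN.sphereDist (v (k + 1)) vs ≤
          C * √‖A * B - B * A‖ * SphereQN.sphereDist (v k) vs) ∧
      (A * B - B * A = 0 →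
        Tendsto v atTop (𝓝 vs) ∧
        ∃ Q : ℝ, ∀ᶠ k in atTop, SphereQN.sphereDist (v (k + 1)) vs ≤
          Q * SphereQN.sphereDist (v k) vs ^ 2) := by
  intro C₀ hC₀ C₁ hC₁ κ hκ
  -- The product is the rate due to the Hessian error; the extra 1 absorbs the quadratic term once Q
  -- d ≤ ‖[A,B]‖^{1/2}. Only δ involves τ.
  refine ⟨4 * κ * (C₁ * C₀) + 1, by positivity, fun τ hτ => ?_⟩
  have hτ1 : 0 < 1 / 2 - τ := by linarith [hτ.2]
  -- With θ = ‖[A,B]‖^{1/2}, the first entry gives Cθ < 1 and the second the smallness of E needed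
  -- for the full step; squaring undoes the root.
  refine ⟨(min (1 / (4 * κ * (C₁ * C₀) + 1)) ((1 / 2 - τ) / (8 * κ * (C₁ * C₀)))) ^ 2,
    by positivity, ?_⟩
  intro n A B As Bs ΔA ΔB H β v vs _ _ hdec hβ hH hrun hcl hest _ hunit
  have hbound := hdec.bound
  refine ⟨fun hne hlt hinv => ?_, fun h0 => ?_⟩
  · have hpos : 0 < √‖A * B - B * A‖ := Real.sqrt_pos.2 (norm_pos_iff.2 hne)
    have hη := (Real.sqrt_lt' (by positivity)).2 hlt
    rw [lt_min_iff, lt_div_iff₀ (by positivity), lt_div_iff₀ (by positivity)] at hη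
    generalize √‖A * B - B * A‖ = θ at *
    have hE : C₁ * (‖ΔA‖ + ‖ΔB‖) ≤ C₁ * (C₀ * θ) := by gcongr
    have hE' : 8 * κ * (C₁ * (‖ΔA‖ + ‖ΔB‖)) ≤ 1 / 2 - τ := by
      calc _ ≤ 8 * κ * (C₁ * (C₀ * θ)) := by gcongr
        _ ≤ _ := by linarith [hη.2]
    obtain ⟨hvs, htend, Q, hQ, hrate⟩ :=
      hrun.tendsto_and_rate hτ hβ hH hcl hest hunit hκ hinv hC₁.le hE'
    refine ⟨htend, by linarith [hη.1], ?_⟩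
    have hsmall : ∀ᶠ k in atTop, SphereQN.sphereDist (v k) vs < θ / (Q + 1) :=
      (SphereQN.tendsto_sphereDist hvs htend).eventually (gt_mem_nhds (by positivity))
    filter_upwards [hrate, hsmall] with k hk hks
    rw [lt_div_iff₀ (by positivity)] at hks
    have hd : 0 ≤ SphereQN.sphereDist (v k) vs := Real.arccos_nonneg _
    generalize SphereQN.sphereDist (v k) vs = d at *
    calc _ ≤ 4 * κ * (C₁ * (‖ΔA‖ + ‖ΔB‖)) * d + Q * d ^ 2 := hk
      _ = (4 * κ * (C₁ * (‖ΔA‖ + ‖ΔB‖)) + Q * d) * d := by ring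
      _ ≤ (4 * κ * (C₁ * (C₀ * θ)) + θ) * d := by
        gcongr
        linarith
      _ = _ := by ring
  · rw [h0, norm_zero, Real.sqrt_zero, mul_zero] at hbound
    have hz : ‖ΔA‖ + ‖ΔB‖ = 0 := le_antisymm hbound (by positivity)
    -- Here E = 0, so any bound on the inverse will do; adding 1 keeps it positive.
    obtain ⟨-, htend, Q, -, hrate⟩ :=
      hrun.tendsto_and_rate (κ := ‖Ring.inverse (H vs)‖ + 1) hτ hβ hH hcl hest hunit
        (by positivity) (by linarith) hC₁.le (by rw [hz]; linarith)
    refine ⟨htend, Q, ?_⟩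
    filter_upwards [hrate] with k hk
    simpa [hz] using hk
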